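/- Let $G=(V,E)$ be a finite simple graph (not necessarily connected) that is a near-triangulation, i.e. $G$ can be drawn in the plane without crossings so that every bounded face is a triangle (bounded by a $3$-cycle of $G$); the outer face may be arbitrary. Suppose that $G$ is $K_4$-free, i.e. no four vertices of $G$ are pairwise adjacent (equivalently, $G$ has no induced subgraph isomorphic to $K_4$). Then $G$ is $3$-colourable if and only if $G$ is word-representable. Here $G$ is $3$-colourable if its vertices can be coloured with at most $3$ colours so that adjacent vertices get different colours, and $G$ is word-representable if there is a finite word $w$ over the alphabet $V$, containing each letter at least once, such that any two distinct letters $x,y\in V$ alternate in $w$ (that is, deleting all other letters from $w$ leaves a word $xyxy\cdots$ or $yxyx\cdots$, of even or odd length) if and only if $xy\in E$. -/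

import Mathlib

/-! ### Word-representable graphs -/

/-- Distinct letters `x` and `y` alternate in the word `w`: deleting all the other letters from
`w` leaves a word of the form `xyxy...` or `yxyx...` (of odd or even length), that is,
a word in which no two consecutive letters are equal. -/
def LettersAlternate {V : Type*} (w : List V) (x y : V) : Prop :=
  open Classical in (w.filter (fun z => z = x ∨ z = y)).IsChain (· ≠ ·)

/-- `G` is word-representable: some (finite) word over the alphabet `V`, in which every letter
occurs, has the property that two distinct letters alternate in it if and only if they
are adjacent in `G`. -/
def IsWordRepresentable {V : Type*} (G : SimpleGraph V) : Prop :=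
  ∃ w : List V, (∀ v : V, v ∈ w) ∧
    ∀ x y : V, x ≠ y → (LettersAlternate w x y ↔ G.Adj x y)

/-! ### Plane embeddings of connected graphs -/

/-- A rotation system on a graph: a cyclic order of the darts (oriented edges) leaving each
vertex. It is given by the permutation `next`, whose cycles are exactly the sets of
darts leaving a common vertex. For a finite connected graph, rotation systems are the embeddings
into closed oriented surfaces with all faces open discs, up to homeomorphism. -/
structure RotationSystem {V : Type*} (G : SimpleGraph V) where
  /-- The next dart in the cyclic order around the initial vertex of a dart. -/
  next : Equiv.Perm G.Dart
  next_fst : ∀ d : G.Dart, (next d).fst = d.fst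
  sameCycle_of_fst_eq : ∀ d d' : G.Dart, d.fst = d'.fst → next.SameCycle d d'

namespace RotationSystem

variable {V : Type*} {G : SimpleGraph V}

/-- Face tracing: walk along the dart `d = (u, v)` to its end `v`, and go on along the dart that
follows `(v, u)` in the cyclic order around `v`. -/
def faceNext (R : RotationSystem G) : Equiv.Perm G.Dart :=
  (Function.Involutive.toPerm SimpleGraph.Dart.symm SimpleGraph.Dart.symm_involutive).trans R.next

/-- The faces of the embedding: the facial closed walks (the cycles of `faceNext`), together with
one face around each isolated vertex, which has no darts in its boundary. -/
def Face (R : RotationSystem G) : Type _ :=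
  Quotient (Equiv.Perm.SameCycle.setoid R.faceNext) ⊕ {v : V // ∀ u, ¬ G.Adj v u}

/-- The length of the boundary of a face: the number of darts in its facial walk, so
that an edge with the same face on both sides is counted twice. -/
noncomputable def faceLength (R : RotationSystem G) : R.Face → ℕ
  | .inl f => Nat.card {d : G.Dart // Quotient.mk (Equiv.Perm.SameCycle.setoid R.faceNext) d = f}
  | .inr _ => 0

/-- A rotation system of a finite connected graph is an embedding into the sphere (equivalently,
into the plane, after the choice of an outer face) when its Euler characteristic
`|V| - |E| + |F|` is `2`, i.e. when its genus is `0`. -/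
def IsSpherical (R : RotationSystem G) : Prop :=
  (Nat.card V : ℤ) - (Nat.card G.edgeSet : ℤ) + (Nat.card R.Face : ℤ) = 2

end RotationSystem

/-! ### Near-triangulations -/

/-- A finite graph `G` is a near-triangulation: it has a plane embedding in which all bounded
faces are triangles. As a bounded triangular face contains no other part of the graph,
all components then lie in the outer face of each other, so that such an embedding amounts to
one of each connected component. The embedding of a component is a rotation system
of genus `0` with a choice of the outer face; the bounded faces are all other ones.
(A closed walk of length `3` in a simple graph is a triangle.) -/
def IsNearTriangulation {V : Type*} (G : SimpleGraph V) : Prop :=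
  ∀ c : G.ConnectedComponent, ∃ R : RotationSystem c.toSimpleGraph,
    R.IsSpherical ∧ ∃ outer : R.Face, ∀ f : R.Face, f ≠ outer → R.faceLength f = 3

/-! ### Alternation and letter counts in prefixes -/

/-! From a 3-colouring to a word: orient each edge from the smaller colour to the larger. Words in
which the ends of every edge read `uvuv...uv`, tail first, can be concatenated without spoiling any
edge, while a non-adjacent pair that fails to alternate in one factor fails in the whole word. So it
suffices to find one such word for each non-adjacent pair (`exists_separating_word_of_le_add_one`,
`exists_separating_word_of_eq_zero_of_eq_two`).

From a word to a 3-colouring: comparing letter counts in prefixes shows that the neighbourhood of a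
vertex induces a comparability graph. Without `K₄` its order has no chain of three elements, so
every neighbourhood is bipartite (`IsWordRepresentable.exists_neighbor_bicoloring`).

The rest is planar topology, one component at a time. Around an inner vertex the neighbours form a
closed walk in a bipartite graph, so inner degrees are even. A closed curve in the dual that avoids
the outer face crosses, modulo 2, as many edges as the sum of the degrees of the vertices it
encloses, hence evenly many; so the triangles can be 2-coloured
(`IsSpherical.exists_region_bicoloring`). Give the darts around a triangle the value 1 or -1 in
`ZMod 3` according to its class. Sums around faces vanish, so on the sphere this cochain has a
potential (`IsSpherical.exists_potential`), which changes along every edge and is a 3-colouring. -/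

theorem LettersAlternate.isChain_and_head_iff {V : Type*} [DecidableEq V] (w : List V) {x y : V}
    (hxy : x ≠ y) :
    ((w.filter (fun z => z = x ∨ z = y)).IsChain (· ≠ ·) ∧
        (w.filter (fun z => z = x ∨ z = y)).head? ≠ some y) ↔
      ∀ n, (w.take n).count y ≤ (w.take n).count x ∧
        (w.take n).count x ≤ (w.take n).count y + 1 := by
  induction w generalizing x y with
  | nil => simp
  | cons z w ih =>
    have key : ∀ p : List V → Prop, (∀ n, p ((z :: w).take n)) ↔ p [] ∧ ∀ n, p (z :: w.take n) := by
      intro p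
      constructor
      · intro h
        exact ⟨by simpa using h 0, fun n => by simpa using h (n + 1)⟩
      · rintro ⟨h0, h1⟩ (_ | n)
        · simpa using h0
        · simpa using h1 n
    rw [key (fun l => l.count y ≤ l.count x ∧ l.count x ≤ l.count y + 1)]
    by_cases hx : z = x
    · subst hx
      -- Once the starting letter has been read the other one is due, so the tail is treated with
      -- the two roles exchanged.
      have h := ih hxy.symm
      have hf : w.filter (fun t => t = y ∨ t = z) = w.filter (fun t => t = z ∨ t = y) := by
        congr 1; ext t; simp [or_comm]
      rw [hf] at h
      have h2 : (∀ n, (z :: w.take n).count y ≤ (z :: w.take n).count z ∧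
          (z :: w.take n).count z ≤ (z :: w.take n).count y + 1) ↔
          ∀ n, (w.take n).count z ≤ (w.take n).count y ∧
            (w.take n).count y ≤ (w.take n).count z + 1 := by
        refine forall_congr' fun n => ?_
        rw [List.count_cons_self, List.count_cons_of_ne hxy]
        omega
      rw [h2, ← h]
      simp only [true_or, decide_true, List.filter_cons_of_pos, List.head?_cons, List.isChain_cons]
      generalize w.filter (fun t => t = z ∨ t = y) = f
      cases f <;> simp [hxy, eq_comm, and_comm]
    · by_cases hy : z = y
      · subst hy
        simp only [or_true, decide_true, List.filter_cons_of_pos, List.head?_cons]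
        constructor
        · rintro ⟨_, h⟩; exact absurd rfl h
        · rintro ⟨_, h⟩
          have := h 0
          simp [hx] at this
      · simp only [List.filter_cons, hx, hy, or_self, decide_false, Bool.false_eq_true, if_false]
        rw [ih hxy]
        simp [List.count_cons_of_ne hx, List.count_cons_of_ne hy]

/-- Two letters alternate, the first one starting, if and only if each prefix of the word
contains equally many of both, or one more of the first. -/
theorem lettersAlternate_iff_count {V : Type*} [DecidableEq V] (w : List V) {x y : V}
    (hxy : x ≠ y) :
    LettersAlternate w x y ↔
      (∀ n, (w.take n).count y ≤ (w.take n).count x ∧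
        (w.take n).count x ≤ (w.take n).count y + 1) ∨
      (∀ n, (w.take n).count x ≤ (w.take n).count y ∧
        (w.take n).count y ≤ (w.take n).count x + 1) := by
  rw [← LettersAlternate.isChain_and_head_iff w hxy,
    ← LettersAlternate.isChain_and_head_iff w hxy.symm]
  have hf : w.filter (fun t => t = y ∨ t = x) = w.filter (fun t => t = x ∨ t = y) := by
    congr 1; ext t; simp [or_comm]
  have hc : LettersAlternate w x y ↔ (w.filter (fun z => z = x ∨ z = y)).IsChain (· ≠ ·) := by
    unfold LettersAlternate
    convert Iff.rfl
  rw [hf, hc, ← and_or_left]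
  refine (and_iff_left ?_).symm
  by_contra! h
  exact hxy (Option.some.inj (h.2.symm.trans h.1))

/-- Reading an occurrence of `x` raises its count and no other, so the difference of two prefix
counts cannot stay constant. -/
theorem eq_of_count_take_eq_add {V : Type*} [DecidableEq V] {w : List V} {x y : V} (hx : x ∈ w)
    {a b : ℕ} (h : ∀ n, (w.take n).count x + a = (w.take n).count y + b) : x = y := by
  obtain ⟨s, t, rfl⟩ := List.append_of_mem hx
  by_contra hxy
  have h1 := h s.length
  have h2 := h (s.length + 1)
  rw [List.take_left] at h1
  rw [List.take_length_add_append, List.take_succ_cons, List.take_zero, List.count_append,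
    List.count_append, List.count_singleton_self, List.count_cons_of_ne hxy] at h2
  simp at h2
  omega

/-! ### Neighbourhoods in word-representable graphs -/

/-- The neighbourhood of a vertex of a word-representable graph induces the comparability graph
of a partial order: here the order is the pointwise order of functions `ℕ → ℕ`. -/
theorem IsWordRepresentable.exists_neighbor_order {V : Type*} {G : SimpleGraph V}
    (hG : IsWordRepresentable G) (v : V) :
    ∃ a : V → ℕ → ℕ, ∀ x y, G.Adj v x → G.Adj v y → x ≠ y →
      a x ≠ a y ∧ (G.Adj x y ↔ a x ≤ a y ∨ a y ≤ a x) := by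
  classical
  obtain ⟨w, hw, hadj⟩ := hG
  let S : V → V → Prop := fun x y => ∀ n, (w.take n).count y ≤ (w.take n).count x ∧
        (w.take n).count x ≤ (w.take n).count y + 1
  have hS : ∀ x y, x ≠ y → (G.Adj x y ↔ S x y ∨ S y x) := fun x y hxy =>
    (hadj x y hxy).symm.trans (lettersAlternate_iff_count w hxy)
  -- The shift `b` puts the counts of all neighbours into one band, between the count of `v` and
  -- that count plus 1. Inside the band two functions differ by at most 1, so comparability is the
  -- same as alternation; if the shifts differ, the empty prefix decides the direction.
  let b : V → ℕ := fun x => if S x v then 0 else 1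
  have hb : ∀ x, G.Adj v x → b x ≤ 1 ∧
      ∀ n, (w.take n).count v ≤ (w.take n).count x + b x ∧
        (w.take n).count x + b x ≤ (w.take n).count v + 1 := by
    intro x hx
    have := (hS v x hx.ne).1 hx
    by_cases h : S x v
    · simp only [b, h, if_true]
      exact ⟨by omega, fun n => by have := h n; omega⟩
    · simp only [b, h, if_false]
      exact ⟨by omega, fun n => by have := this.resolve_right h n; omega⟩
  refine ⟨fun x n => (w.take n).count x + b x, fun x y hx hy hxy => ⟨fun h => ?_, ?_⟩⟩
  · exact hxy (eq_of_count_take_eq_add (hw x) fun n => congrFun h n)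
  · obtain ⟨hbx, hx⟩ := hb x hx
    obtain ⟨hby, hy⟩ := hb y hy
    rw [hS x y hxy]
    simp only [Pi.le_def, S]
    rcases lt_trichotomy (b x) (b y) with h | h | h
    · constructor
      · rintro (h' | h') <;> exact Or.inl fun n => by have := h' n; omega
      · rintro (h' | h')
        · exact Or.inl fun n => by have := h' n; have := hx n; have := hy n; omega
        · have := h' 0; simp at this; omega
    · constructor
      · rintro (h' | h')
        · exact Or.inr fun n => by have := h' n; omega
        · exact Or.inl fun n => by have := h' n; omega
      · rintro (h' | h')
        · exact Or.inr fun n => by have := h' n; have := hx n; have := hy n; omega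
        · exact Or.inl fun n => by have := h' n; have := hx n; have := hy n; omega
    · constructor
      · rintro (h' | h') <;> exact Or.inr fun n => by have := h' n; omega
      · rintro (h' | h')
        · have := h' 0; simp at this; omega
        · exact Or.inr fun n => by have := h' n; have := hx n; have := hy n; omega

/-- In a `K₄`-free word-representable graph every neighbourhood induces a bipartite graph. -/
theorem IsWordRepresentable.exists_neighbor_bicoloring {V : Type*} {G : SimpleGraph V}
    (hG : IsWordRepresentable G) (hK4 : G.CliqueFree 4) (v : V) :
    ∃ κ : V → ZMod 2, ∀ x y, G.Adj v x → G.Adj v y → G.Adj x y → κ x ≠ κ y := by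
  classical
  obtain ⟨a, ha⟩ := hG.exists_neighbor_order v
  -- `T` marks the neighbours that are not maximal. A chain of three neighbours would form a `K₄`
  -- with `v`, so of two comparable ones only the smaller is marked.
  let T : V → Prop := fun x => ∃ z, G.Adj v z ∧ G.Adj x z ∧ a x ≤ a z
  have main : ∀ x y, G.Adj v x → G.Adj v y → G.Adj x y → a x ≤ a y → T x ∧ ¬ T y := by
    intro x y hx hy hxy hle
    refine ⟨⟨y, hy, hxy, hle⟩, ?_⟩
    rintro ⟨z, hz, hyz, hle'⟩
    have hxz : x ≠ z := by
      rintro rfl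
      exact (ha x y hx hy hxy.ne).1 (le_antisymm hle hle')
    have hxz' := (ha x z hx hz hxz).2.2 (Or.inl (hle.trans hle'))
    refine hK4 (insert v {x, y, z})
      ((SimpleGraph.is3Clique_triple_iff.2 ⟨hxy, hxz', hyz⟩).insert ?_)
    simp [hx, hy, hz]
  refine ⟨fun x => if T x then 0 else 1, fun x y hx hy hxy => ?_⟩
  rcases (ha x y hx hy hxy.ne).2.1 hxy with h | h
  · have := main x y hx hy hxy h
    simp [this.1, this.2]
  · have := main y x hy hx hxy.symm h
    simp [this.1, this.2]

/-! ### Words for 3-coloured graphs -/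

theorem List.filter_eq_pair_toList_filter {V : Type*} [Fintype V] [DecidableEq V] (P : V → Prop)
    [DecidablePred P] {u v : V} (h : ¬ (P u ∧ P v)) :
    ((Finset.univ.toList.filter fun z => P z).filter fun z => z = u ∨ z = v) =
      (if P u then [u] else []) ++ if P v then [v] else [] := by
  have hnd : (Finset.univ.toList : List V).Nodup := Finset.nodup_toList _
  have single : ∀ a : V, (Finset.univ.toList : List V).filter (fun z => z = a) = [a] := by
    intro a
    have := hnd.count (a := a)
    rw [List.filter_eq, this, if_pos (by simp)]
    rfl
  rw [List.filter_filter]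
  by_cases hu : P u
  · have hv : ¬ P v := fun hv => h ⟨hu, hv⟩
    rw [← single u]
    simp only [hu, hv, if_true, if_false, List.append_nil]
    refine List.filter_congr fun z _ => ?_
    by_cases h1 : z = u
    · simp [h1, hu]
    · by_cases h2 : z = v
      · subst h2; simp [h1, hv]
      · simp [h1, h2]
  · by_cases hv : P v
    · rw [← single v]
      simp only [hu, hv, if_true, if_false, List.nil_append]
      refine List.filter_congr fun z _ => ?_
      by_cases h1 : z = v
      · simp [h1, hv]
      · by_cases h2 : z = u
        · subst h2; simp [h1, hu]
        · simp [h1, h2]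
    · simp only [hu, hv, if_false, List.append_nil, List.filter_eq_nil_iff]
      intro z _
      by_cases h1 : z = v
      · simp [h1, hv]
      · by_cases h2 : z = u
        · simp [h2, hu]
        · simp [h1, h2]

/-- All letters with property `P`, each once. -/
noncomputable def letterBlock {V : Type*} [Fintype V] (P : V → Prop) : List V :=
  open Classical in Finset.univ.toList.filter fun z => P z

/-- The deletion from `w` of all letters other than `u` and `v`. -/
noncomputable def List.restrictPair {V : Type*} (w : List V) (u v : V) : List V :=
  open Classical in w.filter fun z => z = u ∨ z = v

theorem lettersAlternate_iff_restrictPair {V : Type*} {w : List V} {u v : V} :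
    LettersAlternate w u v ↔ (w.restrictPair u v).IsChain (· ≠ ·) := by
  unfold LettersAlternate List.restrictPair
  convert Iff.rfl

theorem LettersAlternate.symm {V : Type*} {w : List V} {u v : V} (h : LettersAlternate w u v) :
    LettersAlternate w v u := by
  rw [lettersAlternate_iff_restrictPair] at h ⊢
  convert h using 1
  unfold List.restrictPair
  congr 1; ext t; simp [or_comm]

theorem List.restrictPair_append {V : Type*} (w w' : List V) (u v : V) :
    (w ++ w').restrictPair u v = w.restrictPair u v ++ w'.restrictPair u v := by
  simp [List.restrictPair]

open Classical in
theorem restrictPair_letterBlock {V : Type*} [Fintype V] {P : V → Prop} {u v : V}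
    (h : ¬ (P u ∧ P v)) :
    (letterBlock P).restrictPair u v =
      (if P u then [u] else []) ++ if P v then [v] else [] := by
  unfold letterBlock List.restrictPair
  rw [← List.filter_eq_pair_toList_filter P h]

theorem mem_letterBlock {V : Type*} [Fintype V] {P : V → Prop} {v : V} :
    v ∈ letterBlock P ↔ P v := by
  simp [letterBlock]

/-- The letters in the order of their ranks, as far as these are less than `n`. -/
noncomputable def rankWord {V : Type*} [Fintype V] (r : V → ℕ) : ℕ → List V
  | 0 => []
  | n + 1 => rankWord r n ++ letterBlock fun z => r z = n

theorem mem_rankWord {V : Type*} [Fintype V] {r : V → ℕ} {n : ℕ} {v : V} :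
    v ∈ rankWord r n ↔ r v < n := by
  induction n with
  | zero => simp [rankWord]
  | succ n ih => simp [rankWord, ih, mem_letterBlock]; omega

theorem restrictPair_rankWord {V : Type*} [Fintype V] {r : V → ℕ} {u v : V} (h : r u < r v)
    (n : ℕ) : (rankWord r n).restrictPair u v =
      (if r u < n then [u] else []) ++ if r v < n then [v] else [] := by
  induction n with
  | zero => simp [rankWord, List.restrictPair]
  | succ n ih =>
    rw [rankWord, List.restrictPair_append, ih, restrictPair_letterBlock (by omega)]
    rcases lt_trichotomy n (r u) with h1 | h1 | h1
    · simp [show ¬ r u < n by omega, show ¬ r v < n by omega, show ¬ r u < n + 1 by omega,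
        show ¬ r v < n + 1 by omega, show ¬ r u = n by omega, show ¬ r v = n by omega]
    · simp [← h1, show ¬ r v < n by omega, show ¬ r v < n + 1 by omega, show ¬ r v = n by omega]
    · rcases lt_trichotomy n (r v) with h2 | h2 | h2
      · simp [h1, show ¬ r v < n by omega, show r u < n + 1 by omega,
          show ¬ r v < n + 1 by omega, show ¬ r u = n by omega, show ¬ r v = n by omega]
      · simp [h1, ← h2, show r u < n + 1 by omega, show ¬ r u = n by omega]
      · simp [h1, h2, show r u < n + 1 by omega, show r v < n + 1 by omega,
          show ¬ r u = n by omega, show ¬ r v = n by omega]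

theorem restrictPair_rankWord_of_lt {V : Type*} [Fintype V] {r : V → ℕ} {u v : V} {n : ℕ}
    (h : r u < r v) (hn : r v < n) : (rankWord r n).restrictPair u v = [u, v] := by
  rw [restrictPair_rankWord h, if_pos (h.trans hn), if_pos hn]
  rfl

theorem List.restrictPair_comm {V : Type*} (w : List V) (u v : V) :
    w.restrictPair u v = w.restrictPair v u := by
  unfold List.restrictPair
  congr 1; ext t; simp [or_comm]

/-- A word respects the orientation of the edges of `G` by increasing `c` if the two ends of each
edge alternate, the tail coming first and the head last. -/
def RespectsOrientation {V : Type*} (G : SimpleGraph V) (c : V → ℕ) (w : List V) : Prop :=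
  ∀ u v, G.Adj u v → c u < c v → ∃ k, w.restrictPair u v = (List.replicate k [u, v]).flatten

theorem RespectsOrientation.append {V : Type*} {G : SimpleGraph V} {c : V → ℕ} {w w' : List V}
    (h : RespectsOrientation G c w) (h' : RespectsOrientation G c w') :
    RespectsOrientation G c (w ++ w') := by
  intro u v huv hc
  obtain ⟨k, hk⟩ := h u v huv hc
  obtain ⟨l, hl⟩ := h' u v huv hc
  exact ⟨k + l, by rw [List.restrictPair_append, hk, hl, List.replicate_add, List.flatten_append]⟩

theorem RespectsOrientation.flatten {V : Type*} {G : SimpleGraph V} {c : V → ℕ}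
    {L : List (List V)} (h : ∀ w ∈ L, RespectsOrientation G c w) :
    RespectsOrientation G c L.flatten := by
  induction L with
  | nil => exact fun u v _ _ => ⟨0, by simp [List.restrictPair]⟩
  | cons w L ih =>
    rw [List.flatten_cons]
    exact (h w (by simp)).append (ih fun w hw => h w (by simp [hw]))

theorem respectsOrientation_rankWord {V : Type*} [Fintype V] {G : SimpleGraph V} {c r : V → ℕ}
    {n : ℕ} (h : ∀ u v, G.Adj u v → c u < c v → r u < r v) (hn : ∀ v, r v < n) :
    RespectsOrientation G c (rankWord r n) := fun u v huv hc =>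
  ⟨1, by simp [restrictPair_rankWord_of_lt (h u v huv hc) (hn v)]⟩

theorem RespectsOrientation.lettersAlternate {V : Type*} {G : SimpleGraph V} {c : V → ℕ}
    {w : List V} (h : RespectsOrientation G c w) {u v : V} (huv : G.Adj u v) (hc : c u < c v) :
    LettersAlternate w u v := by
  obtain ⟨k, hk⟩ := h u v huv hc
  rw [lettersAlternate_iff_restrictPair, hk]
  -- The condition on the first letter lets the induction put `[u, v]`, which ends in `v`, in front.
  suffices H : ((List.replicate k [u, v]).flatten).IsChain (· ≠ ·) ∧
      ((List.replicate k [u, v]).flatten).head? ≠ some v from H.1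
  clear hk
  induction k with
  | zero => simp
  | succ k ih =>
    have ih' := ih
    rw [List.replicate_succ, List.flatten_cons]
    generalize (List.replicate k [u, v]).flatten = l at ih'
    cases l with
    | nil => simp [huv.ne]
    | cons a l =>
      simp at ih'
      simp [huv.ne, ih'.1, Ne.symm ih'.2]

/-- Non-adjacent vertices whose colours are equal or consecutive are separated by two linear
extensions of the orientation. -/
theorem exists_separating_word_of_le_add_one {V : Type*} [Fintype V] {G : SimpleGraph V}
    {c : V → ℕ} (hc : ∀ v, c v < 3) {x y : V} (hxy : x ≠ y) (hadj : ¬ G.Adj x y)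
    (h1 : c x ≤ c y) (h2 : c y ≤ c x + 1) :
    ∃ w, RespectsOrientation G c w ∧ ¬ LettersAlternate w x y := by
  classical
  -- Colour classes are 3 apart. Offsets 0 and 4 around the common 2 move a vertex past a
  -- neighbouring class only relative to the other special vertex: `r` puts `x` before `y`, `s` puts
  -- `y` before `x`, and the only edge `s` could reverse is the absent `xy`. The two words together
  -- restrict to `xyyx`.
  let r : V → ℕ := fun v => if v = x then 3 * c v else if v = y then 3 * c v + 4 else 3 * c v + 2
  let s : V → ℕ := fun v => if v = x then 3 * c v + 4 else if v = y then 3 * c v else 3 * c v + 2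
  have hr : r x < r y := by simp [r, hxy.symm]; omega
  have hs : s y < s x := by simp [s, hxy.symm]; omega
  have hrn : ∀ v, r v < 15 := fun v => by
    have := hc v
    simp only [r]; split_ifs <;> omega
  have hsn : ∀ v, s v < 15 := fun v => by
    have := hc v
    simp only [s]; split_ifs <;> omega
  refine ⟨rankWord r 15 ++ rankWord s 15, .append (respectsOrientation_rankWord ?_ hrn)
    (respectsOrientation_rankWord ?_ hsn), ?_⟩
  · intro u v huv huv'
    simp only [r]
    split_ifs with a b b d d
    all_goals first | omega | (subst_vars; omega)
  · intro u v huv huv'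
    simp only [s]
    split_ifs with a b b d d
    all_goals first | omega | (subst_vars; first | omega | exact absurd huv hadj)
  · rw [lettersAlternate_iff_restrictPair, List.restrictPair_append,
      restrictPair_rankWord_of_lt hr (hrn y), List.restrictPair_comm,
      restrictPair_rankWord_of_lt hs (hsn x)]
    simp

/-- A path through colour 1 may force `x` before `y` in every linear extension, so swapping them is
impossible. Instead the word lists the colour classes twice, with the second `x` and the first `y`
moved to the middle: every edge still reads `uvuv`, but the pair reads `xxyy`. -/
theorem exists_separating_word_of_eq_zero_of_eq_two {V : Type*} [Fintype V] {G : SimpleGraph V}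
    {c : V → ℕ} (hc : ∀ v, c v < 3) {x y : V} (hadj : ¬ G.Adj x y)
    (hx : c x = 0) (hy : c y = 2) :
    ∃ w, RespectsOrientation G c w ∧ ¬ LettersAlternate w x y := by
  classical
  have hxy : x ≠ y := by rintro rfl; omega
  refine ⟨letterBlock (fun v => c v = 0) ++ (letterBlock (fun v => c v = 1) ++
    (letterBlock (fun v => c v = 2 ∧ v ≠ y) ++ (letterBlock (fun v => v = x) ++
    (letterBlock (fun v => v = y) ++ (letterBlock (fun v => c v = 0 ∧ v ≠ x) ++
    (letterBlock (fun v => c v = 1) ++ letterBlock (fun v => c v = 2))))))), ?_, ?_⟩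
  · intro u v huv huv'
    have huv_ne := huv.ne
    refine ⟨2, ?_⟩
    simp only [List.restrictPair_append]
    repeat rw [restrictPair_letterBlock]
    rotate_left
    iterate 7 (first | omega | (rintro ⟨rfl, rfl⟩; exact huv_ne rfl))
    have hu2 : c u = 0 ∨ c u = 1 := by have := hc v; omega
    have hv2 : c v = 1 ∨ c v = 2 := by have := hc v; omega
    have hxv : v ≠ x := by rintro rfl; omega
    have hyu : u ≠ y := by rintro rfl; have := hc v; omega
    rcases hu2 with hu | hu
    · rcases hv2 with hv | hv
      · have hvy : v ≠ y := by rintro rfl; omega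
        by_cases hux : u = x <;> simp [hu, hv, hxv, hyu, hvy, hux, hxy, hx]
      · by_cases hux : u = x
        · have hvy : v ≠ y := by rintro rfl; exact hadj (hux ▸ huv)
          simp [hv, hxv, hvy, hux, hxy, hx]
        · by_cases hvy : v = y
          · simp [hu, hyu, hvy, hux, hxy.symm, hy]
          · simp [hu, hv, hxv, hyu, hvy, hux]
    · have hux : u ≠ x := by rintro rfl; omega
      have hv : c v = 2 := by omega
      by_cases hvy : v = y
      · simp [hu, hyu, hvy, hux, hxy.symm, hy]
      · simp [hu, hv, hxv, hyu, hvy, hux]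
  · rw [lettersAlternate_iff_restrictPair]
    simp only [List.restrictPair_append]
    repeat rw [restrictPair_letterBlock]
    rotate_left
    iterate 7 (first | omega | (rintro ⟨h, h'⟩; simp_all))
    simp [hx, hy, hxy, hxy.symm]

/-- Every 3-colourable finite graph is word-representable. -/
theorem SimpleGraph.Colorable.isWordRepresentable {V : Type*} [Finite V] {G : SimpleGraph V}
    (hG : G.Colorable 3) : IsWordRepresentable G := by
  classical
  have := Fintype.ofFinite V
  obtain ⟨C⟩ := hG
  let c : V → ℕ := fun v => (C v).val
  have hc : ∀ v, c v < 3 := fun v => (C v).isLt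
  have hne : ∀ u v, G.Adj u v → c u ≠ c v := fun u v h h' => C.valid h (Fin.ext h')
  have sep : ∀ p : V × V, ∃ w, RespectsOrientation G c w ∧
      (p.1 ≠ p.2 → ¬ G.Adj p.1 p.2 → ¬ LettersAlternate w p.1 p.2) := by
    have key : ∀ x y, x ≠ y → ¬ G.Adj x y → c x ≤ c y →
        ∃ w, RespectsOrientation G c w ∧ ¬ LettersAlternate w x y := by
      intro x y hxy hadj hle
      by_cases h : c y ≤ c x + 1
      · exact exists_separating_word_of_le_add_one hc hxy hadj hle h
      · have := hc y
        exact exists_separating_word_of_eq_zero_of_eq_two hc hadj (by omega) (by omega)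
    rintro ⟨x, y⟩
    by_cases hxy : x ≠ y ∧ ¬ G.Adj x y
    · rcases le_total (c x) (c y) with h | h
      · obtain ⟨w, hw, hw'⟩ := key x y hxy.1 hxy.2 h
        exact ⟨w, hw, fun _ _ => hw'⟩
      · obtain ⟨w, hw, hw'⟩ := key y x hxy.1.symm (fun h => hxy.2 h.symm) h
        exact ⟨w, hw, fun _ _ h => hw' h.symm⟩
    · exact ⟨[], fun u v _ _ => ⟨0, by simp [List.restrictPair]⟩, fun h h' => absurd ⟨h, h'⟩ hxy⟩
  choose f hf hf' using sep
  let L : List V := ((Finset.univ : Finset (V × V)).toList.map f).flatten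
  -- The factor `rankWord c 3` makes every letter occur, even if `L` is empty.
  have hL : RespectsOrientation G c (rankWord c 3 ++ L) :=
    (respectsOrientation_rankWord (fun u v _ h => h) hc).append <|
      RespectsOrientation.flatten fun w hw => by
        obtain ⟨p, -, rfl⟩ := List.mem_map.1 hw
        exact hf p
  refine ⟨rankWord c 3 ++ L, fun v => List.mem_append_left _ (mem_rankWord.2 (hc v)),
    fun x y hxy => ⟨fun h => ?_, fun h => ?_⟩⟩
  · by_contra hadj
    refine hf' (x, y) hxy hadj ?_
    rw [lettersAlternate_iff_restrictPair] at h ⊢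
    have hinf : f (x, y) <:+: rankWord c 3 ++ L :=
      (List.infix_of_mem_flatten (List.mem_map.2 ⟨(x, y), by simp, rfl⟩)).trans
        (List.suffix_append _ _).isInfix
    exact h.infix (hinf.filter _)
  · rcases lt_or_gt_of_ne (hne x y h) with h' | h'
    · exact hL.lettersAlternate h h'
    · exact (hL.lettersAlternate h.symm h').symm

/-! ### Cohomology of rotation systems of genus zero -/

theorem Equiv.Perm.SameCycle.apply_eq_of_invariant {α β : Type*} {σ : Equiv.Perm α} {x y : α}
    (h : σ.SameCycle x y) {f : α → β} (hf : ∀ z, f (σ z) = f z) : f x = f y := by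
  obtain ⟨i, rfl⟩ := h
  induction i with
  | zero => simp
  | succ i ih => rw [ih, add_comm, zpow_add, Equiv.Perm.mul_apply, zpow_one, hf]
  | pred i ih =>
    rw [ih, ← hf ((σ ^ (-(i : ℤ) - 1)) x), ← Equiv.Perm.mul_apply, ← zpow_one_add]
    congr 3
    ring

namespace RotationSystem

variable {V : Type*} {G : SimpleGraph V}

/-- The faces with a nonempty boundary. -/
abbrev Region (R : RotationSystem G) : Type _ :=
  Quotient (Equiv.Perm.SameCycle.setoid R.faceNext)

/-- The face whose facial walk contains the dart `d`. -/
def region (R : RotationSystem G) (d : G.Dart) : R.Region :=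
  Quotient.mk (Equiv.Perm.SameCycle.setoid R.faceNext) d

variable (R : RotationSystem G)

theorem region_eq_iff {d d' : G.Dart} : R.region d = R.region d' ↔ R.faceNext.SameCycle d d' :=
  Quotient.eq (r := Equiv.Perm.SameCycle.setoid R.faceNext)

theorem region_surjective : Function.Surjective R.region :=
  Quotient.mk_surjective

theorem faceNext_apply (d : G.Dart) : R.faceNext d = R.next d.symm := rfl

theorem faceNext_fst (d : G.Dart) : (R.faceNext d).fst = d.snd :=
  R.next_fst d.symm

theorem region_faceNext (d : G.Dart) : R.region (R.faceNext d) = R.region d :=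
  R.region_eq_iff.2 (Equiv.Perm.sameCycle_apply_left.2 (Equiv.Perm.SameCycle.refl _ _))

theorem region_next (d : G.Dart) : R.region (R.next d) = R.region d.symm := by
  rw [← R.region_faceNext d.symm, faceNext_apply, SimpleGraph.Dart.symm_symm]

/-- In a connected graph, one can get from each face to each other by crossing edges. -/
theorem eq_of_crossing_invariant {β : Type*} (hconn : G.Connected) {φ : R.Region → β}
    (hφ : ∀ d, φ (R.region d.symm) = φ (R.region d)) (q q' : R.Region) : φ q = φ q' := by
  have hfst : ∀ d d' : G.Dart, d.fst = d'.fst → φ (R.region d) = φ (R.region d') := fun d d' h =>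
    (R.sameCycle_of_fst_eq d d' h).apply_eq_of_invariant (f := fun d => φ (R.region d))
      fun z => by rw [region_next, hφ]
  have hwalk : ∀ {u v : V}, G.Walk u v → ∀ d d' : G.Dart, d.fst = u → d'.fst = v →
      φ (R.region d) = φ (R.region d') := by
    intro u v p
    induction p with
    | nil => exact fun d d' h h' => hfst d d' (h.trans h'.symm)
    | @cons u v w huv p ih =>
      intro d d' h h'
      let e : G.Dart := ⟨(u, v), huv⟩
      rw [hfst d e h, ← hφ e]
      exact ih e.symm d' rfl h'
  obtain ⟨d, rfl⟩ := R.region_surjective q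
  obtain ⟨d', rfl⟩ := R.region_surjective q'
  exact hwalk (hconn.preconnected d.fst d'.fst).some d d' rfl rfl

/-- The cochains on the oriented edges of `G`. -/
def antisymmetric (K : Type*) [Field K] (G : SimpleGraph V) : Submodule K (G.Dart → K) where
  carrier := {f | ∀ d, f d.symm = -f d}
  add_mem' hf hg d := by simp [hf d, hg d]; ring
  zero_mem' d := by simp
  smul_mem' c f hf d := by simp [hf d]

/-- A cochain is determined by its values on one chosen dart of each edge. -/
theorem finrank_antisymmetric_le (K : Type*) [Field K] [Finite V] (G : SimpleGraph V) :
    Module.finrank K (antisymmetric K G) ≤ Nat.card G.edgeSet := by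
  classical
  have := Fintype.ofFinite V
  have hρ : ∀ e : G.edgeSet, ∃ d : G.Dart, d.edge = e := by
    rintro ⟨e, he⟩
    induction e with
    | h u v => exact ⟨⟨(u, v), he⟩, rfl⟩
  choose ρ hρ using hρ
  have hinj : Function.Injective
      ((LinearMap.funLeft K K ρ).comp (antisymmetric K G).subtype) := by
    rw [injective_iff_map_eq_zero]
    intro f hf
    ext d
    have h := congrFun hf ⟨d.edge, d.edge_mem⟩
    have hd := hρ ⟨d.edge, d.edge_mem⟩
    simp only [LinearMap.comp_apply, LinearMap.funLeft_apply, Submodule.subtype_apply,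
      Pi.zero_apply] at h
    rcases (SimpleGraph.dart_edge_eq_iff _ _).1 hd with h' | h'
    · rw [h'] at h
      simpa using h
    · rw [h', f.2 d] at h
      simpa using h
  have := LinearMap.finrank_le_finrank_of_injective hinj
  rwa [Module.finrank_fintype_fun_eq_card, ← Nat.card_eq_fintype_card] at this

/-- The coboundary of a function on the vertices. -/
def coboundary (K : Type*) [Field K] (G : SimpleGraph V) : (V → K) →ₗ[K] antisymmetric K G where
  toFun p := ⟨fun d => p d.snd - p d.fst, fun d => by simp⟩
  map_add' p q := by ext d; simp; ring
  map_smul' c p := by ext d; simp; ring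

/-- By connectedness the kernel of the coboundary consists of constants. -/
theorem card_le_finrank_range_coboundary_add_one (K : Type*) [Field K] [Finite V]
    (hconn : G.Connected) :
    Nat.card V ≤ Module.finrank K (LinearMap.range (coboundary K G)) + 1 := by
  have := Fintype.ofFinite V
  have h := LinearMap.finrank_range_add_finrank_ker (coboundary K G)
  rw [Module.finrank_fintype_fun_eq_card, ← Nat.card_eq_fintype_card] at h
  have hker : LinearMap.ker (coboundary K G) ≤ Submodule.span K {fun _ => (1 : K)} := by
    intro p hp
    have hadj : ∀ u v, G.Adj u v → p u = p v := fun u v huv => by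
      have h := congrFun (congrArg Subtype.val (LinearMap.mem_ker.1 hp)) ⟨(u, v), huv⟩
      simp only [coboundary, LinearMap.coe_mk, AddHom.coe_mk, Submodule.coe_zero,
        Pi.zero_apply] at h
      exact (sub_eq_zero.1 h).symm
    obtain ⟨v₀⟩ := hconn.nonempty
    refine Submodule.mem_span_singleton.2 ⟨p v₀, funext fun v => ?_⟩
    obtain ⟨w⟩ := hconn.preconnected v₀ v
    have : p v₀ = p v := by
      induction w with
      | nil => rfl
      | cons huv _ ih => exact (hadj _ _ huv).trans ih
    simp [this]
  have h1 := Submodule.finrank_mono hker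
  obtain ⟨v₀⟩ := hconn.nonempty
  have h2 := finrank_span_singleton (K := K) (v := fun _ : V => (1 : K))
    fun h => one_ne_zero (congrFun h v₀)
  omega

/-- The sums of a function on the darts along the facial walks. -/
def faceSum (K : Type*) [Field K] [Fintype G.Dart] [DecidableEq R.Region] :
    (G.Dart → K) →ₗ[K] (R.Region → K) where
  toFun f q := ∑ d with R.region d = q, f d
  map_add' f g := by ext q; simp [Finset.sum_add_distrib]
  map_smul' c f := by ext q; simp [Finset.mul_sum]

theorem faceSum_apply {K : Type*} [Field K] [Fintype G.Dart] [DecidableEq R.Region]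
    (f : G.Dart → K) (q : R.Region) : R.faceSum K f q = ∑ d with R.region d = q, f d := rfl

theorem faceSum_coboundary (K : Type*) [Field K] [Fintype G.Dart] [DecidableEq R.Region]
    (p : V → K) : R.faceSum K (coboundary K G p) = 0 := by
  ext q
  have h : ∑ d with R.region d = q, p d.snd = ∑ d with R.region d = q, p d.fst :=
    Finset.sum_equiv R.faceNext (by simp [region_faceNext]) fun d _ => by rw [faceNext_fst]
  simp [faceSum_apply, coboundary, h]

/-- The cochain supported on a single edge has as face sums the difference of the indicators of the
faces on its two sides. As all faces are linked by crossings, all indicators agree modulo the range,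
which thus has codimension at most 1. -/
theorem card_le_finrank_range_faceSum_add_one (K : Type*) [Field K] [Fintype G.Dart]
    [DecidableEq R.Region] (hconn : G.Connected) :
    Nat.card R.Region ≤ Module.finrank K
      (LinearMap.range ((R.faceSum K).domRestrict (antisymmetric K G))) + 1 := by
  classical
  have := Fintype.ofFinite R.Region
  set W := LinearMap.range ((R.faceSum K).domRestrict (antisymmetric K G))
  rcases isEmpty_or_nonempty R.Region with hE | ⟨⟨q₀⟩⟩
  · simp
  have hcross : ∀ q, W.mkQ (Pi.single q 1) = W.mkQ (Pi.single q₀ 1) := by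
    intro q
    refine R.eq_of_crossing_invariant hconn (φ := fun q => W.mkQ (Pi.single q 1))
      (fun d => ?_) q q₀
    rw [← sub_eq_zero, ← map_sub, Submodule.mkQ_apply, Submodule.Quotient.mk_eq_zero]
    refine ⟨⟨Pi.single d.symm 1 - Pi.single d 1, fun e => ?_⟩, ?_⟩
    · have h1 : e.symm = d.symm ↔ e = d := SimpleGraph.Dart.symm_involutive.injective.eq_iff
      have h2 : e.symm = d ↔ e = d.symm := SimpleGraph.Dart.symm_involutive.eq_iff
      simp [Pi.single_apply, h1, h2]
    · ext q
      simp only [LinearMap.domRestrict_apply, faceSum_apply, Pi.sub_apply,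
        Finset.sum_sub_distrib, Pi.single_apply, Finset.sum_ite_eq', Finset.mem_filter,
        Finset.mem_univ, true_and]
      simp only [eq_comm]
  have htop : W ⊔ Submodule.span K {Pi.single q₀ 1} = ⊤ := by
    rw [eq_top_iff]
    intro x _
    rw [pi_eq_sum_univ' x]
    refine Submodule.sum_mem _ fun q _ => Submodule.smul_mem _ _ ?_
    have h := hcross q
    rw [← sub_eq_zero, ← map_sub, Submodule.mkQ_apply, Submodule.Quotient.mk_eq_zero] at h
    rw [← sub_add_cancel (Pi.single q 1 : R.Region → K) (Pi.single q₀ 1)]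
    exact Submodule.add_mem_sup h (Submodule.mem_span_singleton_self _)
  have h1 := Submodule.finrank_add_le_finrank_add_finrank W
    (Submodule.span K {Pi.single q₀ (1 : K)})
  have h2 := finrank_span_singleton (K := K) (v := (Pi.single q₀ 1 : R.Region → K)) (by simp)
  rw [htop, finrank_top, Module.finrank_fintype_fun_eq_card, ← Nat.card_eq_fintype_card] at h1
  omega

/-- The first cohomology of the sphere vanishes: an antisymmetric function on the darts whose sum
along each facial walk is zero is a coboundary. -/
theorem IsSpherical.exists_potential {R : RotationSystem G} (hR : R.IsSpherical)
    {K : Type*} [Field K] [Finite V] [Fintype G.Dart] [DecidableEq R.Region]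
    (hconn : G.Connected) (hiso : ∀ v, ∃ u, G.Adj v u) {f : G.Dart → K}
    (hf : ∀ d, f d.symm = -f d) (hsum : ∀ q, ∑ d with R.region d = q, f d = 0) :
    ∃ p : V → K, ∀ d, f d = p d.snd - p d.fst := by
  classical
  have hface : Nat.card R.Face = Nat.card R.Region := by
    have : IsEmpty {v : V // ∀ u, ¬ G.Adj v u} :=
      ⟨fun v => (hiso v.1).elim fun u hu => v.2 u hu⟩
    exact Nat.card_congr (Equiv.sumEmpty _ _)
  let D := (R.faceSum K).domRestrict (antisymmetric K G)
  have hle : LinearMap.range (coboundary K G) ≤ LinearMap.ker D := by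
    rintro _ ⟨p, rfl⟩
    exact R.faceSum_coboundary K p
  have h1 := LinearMap.finrank_range_add_finrank_ker D
  have h2 := finrank_antisymmetric_le K G
  have h3 := card_le_finrank_range_coboundary_add_one K hconn
  have h4 : Nat.card R.Region ≤ Module.finrank K (LinearMap.range D) + 1 :=
    R.card_le_finrank_range_faceSum_add_one K hconn
  have h5 : (Nat.card V : ℤ) - Nat.card G.edgeSet + Nat.card R.Face = 2 := hR
  -- The range has dimension at least `|V| - 1`, the kernel at most `|E| - |F| + 1`; Euler's formula
  -- makes these equal.
  have heq := Submodule.eq_of_le_of_finrank_le hle (by rw [hface] at h5; omega)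
  have hmem : (⟨f, hf⟩ : antisymmetric K G) ∈ LinearMap.ker D := by
    rw [LinearMap.mem_ker]
    ext q
    exact hsum q
  rw [← heq] at hmem
  obtain ⟨p, hp⟩ := hmem
  exact ⟨p, fun d => (congrFun (congrArg Subtype.val hp) d).symm⟩

/-! ### Near-triangulations with bipartite neighbourhoods -/

/-- A face of length three is a triangle. -/
theorem faceNext_faceNext_faceNext {d : G.Dart}
    (h : Nat.card {d' : G.Dart // R.region d' = R.region d} = 3) :
    R.faceNext (R.faceNext (R.faceNext d)) = d := by
  classical
  set φ := R.faceNext with hφ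
  have hne : ∀ e, φ e ≠ e := fun e he => e.fst_ne_snd (by rw [← R.faceNext_fst e, ← hφ, he])
  have hfin : {d' : G.Dart | R.region d' = R.region d}.Finite := by
    rw [Set.finite_coe_iff.symm]
    exact Nat.finite_of_card_ne_zero (by rw [Set.coe_ofPred, h]; omega)
  have hcard : {d' : G.Dart | R.region d' = R.region d}.ncard = 3 := h
  have h2 : φ (φ d) ≠ d := by
    intro hd
    have hsub : {d' : G.Dart | R.region d' = R.region d} ⊆ {d, φ d} := by
      intro e he
      have := ((R.region_eq_iff.1 he).symm.apply_eq_of_invariant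
        (f := fun z => z = d ∨ z = φ d) fun z => by
          have h1 : φ z = d ↔ z = φ d := by rw [← φ.injective.eq_iff (b := φ d), hd]
          have h2 : φ z = φ d ↔ z = d := φ.injective.eq_iff
          change (φ z = d ∨ φ z = φ d) = (z = d ∨ z = φ d)
          rw [h1, h2, or_comm])
      simpa using this
    have := Set.ncard_le_ncard hsub
    rw [hcard, Set.ncard_pair (hne d).symm] at this
    omega
  by_contra h3
  have hsub : (({d, φ d, φ (φ d), φ (φ (φ d))} : Finset G.Dart) : Set G.Dart) ⊆
      {d' : G.Dart | R.region d' = R.region d} := by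
    intro e he
    simp only [Finset.coe_insert, Finset.coe_singleton, Set.mem_insert_iff,
      Set.mem_singleton_iff] at he
    rcases he with rfl | rfl | rfl | rfl <;> simp [hφ, region_faceNext]
  have := Set.ncard_le_ncard hsub hfin
  rw [hcard, Set.ncard_coe_finset, Finset.card_insert_of_notMem, Finset.card_insert_of_notMem,
    Finset.card_pair (hne _).symm] at this
  · omega
  · simp only [Finset.mem_insert, Finset.mem_singleton, φ.injective.eq_iff, not_or]
    exact ⟨(hne _).symm, h2.symm⟩
  · simp only [Finset.mem_insert, Finset.mem_singleton, not_or]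
    exact ⟨(hne _).symm, h2.symm, Ne.symm h3⟩

/-- The neighbours of `v` in consecutive directions at a corner of a triangle are adjacent. -/
theorem adj_snd_next_snd {d : G.Dart}
    (h : Nat.card {d' : G.Dart // R.region d' = R.region (R.next d)} = 3) :
    G.Adj d.snd (R.next d).snd := by
  have hd : R.faceNext d.symm = R.next d := by
    rw [faceNext_apply, SimpleGraph.Dart.symm_symm]
  rw [← hd, region_faceNext] at h
  have h3 := R.faceNext_faceNext_faceNext h
  rw [hd] at h3
  have h1 := R.faceNext_fst (R.next d)
  have h2 := R.faceNext_fst (R.faceNext (R.next d))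
  rw [h3] at h2
  have h4 := (R.faceNext (R.next d)).adj
  rw [h1, ← h2] at h4
  exact h4.symm

/-- If all faces but one are triangles and all neighbourhoods are bipartite, then the triangles can
be 2-coloured so that adjacent ones have different colours. -/
theorem IsSpherical.exists_region_bicoloring {R : RotationSystem G} (hR : R.IsSpherical)
    [Finite V] (hconn : G.Connected) (hiso : ∀ v, ∃ u, G.Adj v u) (outer : R.Region)
    (htri : ∀ q, q ≠ outer → Nat.card {d : G.Dart // R.region d = q} = 3)
    {κ : V → V → ZMod 2}
    (hκ : ∀ v x y, G.Adj v x → G.Adj v y → G.Adj x y → κ v x ≠ κ v y) :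
    ∃ s : R.Region → ZMod 2, ∀ d, R.region d ≠ outer → R.region d.symm ≠ outer →
      s (R.region d) + s (R.region d.symm) = 1 := by
  classical
  have := Fintype.ofFinite V
  have := Fintype.ofFinite G.Dart
  let inner : G.Dart → Prop := fun d => R.region d ≠ outer ∧ R.region d.symm ≠ outer
  let A : (R.Region → ZMod 2) →ₗ[ZMod 2] (G.Dart → ZMod 2) :=
    { toFun := fun s d => if inner d then s (R.region d) + s (R.region d.symm) else 0
      map_add' := fun s t => by ext d; by_cases h : inner d <;> simp [h]; ring
      map_smul' := fun c s => by ext d; by_cases h : inner d <;> simp [h]; ring }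
  let t : G.Dart → ZMod 2 := fun d => if inner d then 1 else 0
  suffices ht : t ∈ LinearMap.range A by
    obtain ⟨s, hs⟩ := ht
    refine ⟨s, fun d h h' => ?_⟩
    have := congrFun hs d
    simpa [A, t, show inner d from ⟨h, h'⟩] using this
  -- If the linear system has no solution, some functional kills the range of `A` but not `t`. Its
  -- coefficients `y` play the part of a dual cycle crossing an odd number of inner edges.
  by_contra ht
  obtain ⟨f, hft, hfA⟩ := Submodule.exists_dual_map_eq_bot_of_notMem ht inferInstance
  let y : G.Dart → ZMod 2 := fun d => if inner d then f (Pi.single d 1) else 0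
  have hfsum : ∀ g : G.Dart → ZMod 2, f g = ∑ d, g d * f (Pi.single d 1) := by
    intro g
    rw [LinearMap.pi_apply_eq_sum_univ f g]
    refine Finset.sum_congr rfl fun d _ => ?_
    rw [smul_eq_mul]
    congr 2
    ext j
    simp [Pi.single_apply, eq_comm]
  have hfA' : ∀ s : R.Region → ZMod 2, ∑ d, (s (R.region d) + s (R.region d.symm)) * y d = 0 := by
    intro s
    have h : f (A s) = 0 := by
      have : f (A s) ∈ (LinearMap.range A).map f := ⟨A s, ⟨s, rfl⟩, rfl⟩
      rw [hfA] at this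
      exact (Submodule.mem_bot _).1 this
    rw [hfsum] at h
    rw [← h]
    refine Finset.sum_congr rfl fun d _ => ?_
    by_cases hd : inner d <;> simp [A, y, hd]
  have hft' : ∑ d, y d ≠ 0 := by
    intro h
    refine hft ?_
    rw [hfsum, ← h]
    refine Finset.sum_congr rfl fun d _ => ?_
    by_cases hd : inner d <;> simp [t, y, hd]
  have hsymm : ∀ g : G.Dart → ZMod 2, ∑ d : G.Dart, g d.symm = ∑ d, g d := fun g =>
    Equiv.sum_comp (Function.Involutive.toPerm _ SimpleGraph.Dart.symm_involutive) g
  have hX : ∀ q, ∑ d with R.region d = q, (y d + y d.symm) = 0 := by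
    intro q
    have h := hfA' (fun q' => if q' = q then 1 else 0)
    simp only [add_mul, Finset.sum_add_distrib] at h
    rw [← hsymm (fun d => (if R.region d.symm = q then 1 else 0) * y d)] at h
    simp only [SimpleGraph.Dart.symm_symm, ite_mul, one_mul, zero_mul] at h
    rw [Finset.sum_add_distrib, Finset.sum_filter, Finset.sum_filter, h]
  -- The dual cycle is the edge boundary of a set of vertices, with indicator `p` up to a constant.
  obtain ⟨p, hp⟩ := hR.exists_potential hconn hiso (f := fun d => y d + y d.symm)
    (fun d => by rw [CharTwo.neg_eq, SimpleGraph.Dart.symm_symm, add_comm]) hX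
  obtain ⟨d₀, hd₀⟩ := R.region_surjective outer
  let r : V → ZMod 2 := fun v => p v - p d₀.fst
  -- Edges on the outer face carry no `y`, so `p` is constant along its facial walk; vertices with
  -- `r` nonzero are therefore inner.
  have hr : ∀ d, R.region d = outer → r d.fst = 0 := by
    intro d hd
    have h := (R.region_eq_iff.1 (hd.trans hd₀.symm)).apply_eq_of_invariant
      (f := fun e => if R.region e = outer then p e.fst else 0) (fun e => by
        rw [region_faceNext, faceNext_fst]
        by_cases he : R.region e = outer
        · have h1 : ¬ inner e := fun h => h.1 he
          have h2 : ¬ inner e.symm := fun h => h.2 (by simpa using he)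
          have h3 := hp e
          simp only [y, h1, h2, if_false, add_zero] at h3
          simp only [he, if_true]
          exact sub_eq_zero.1 h3.symm
        · simp [he])
    simp only [hd, hd₀, if_true] at h
    simp [r, h]
  have hy : ∑ d, (y d - r d.fst) = 0 := by
    refine Finset.sum_involution (fun d _ => d.symm) (fun d _ => ?_) (fun d _ _ => d.symm_ne)
      (fun _ _ => Finset.mem_univ _) (fun d _ => d.symm_symm)
    have h := hp d
    have h2 : (d.symm).fst = d.snd := rfl
    simp only [r, h2]
    linear_combination h + (p d₀.fst - p d.fst) * CharTwo.two_eq_zero (R := ZMod 2)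
  -- Around an inner vertex `κ` flips from each dart to the next. Summed over all darts, the left
  -- side telescopes under `R.next`, which expresses that inner degrees are even.
  have hdiff : ∀ d, r (R.next d).fst * κ (R.next d).fst (R.next d).snd
      - r d.fst * κ d.fst d.snd = r d.fst := by
    intro d
    rw [R.next_fst]
    by_cases h0 : r d.fst = 0
    · simp [h0]
    · have hq : R.region (R.next d) ≠ outer := fun h => h0 (by
        rw [← R.next_fst d]; exact hr _ h)
      have hadj' := (R.next d).adj
      rw [R.next_fst] at hadj'
      have hne := hκ d.fst d.snd (R.next d).snd d.adj hadj'
        (R.adj_snd_next_snd (htri _ hq))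
      generalize κ d.fst d.snd = a at hne ⊢
      generalize κ d.fst (R.next d).snd = b at hne ⊢
      generalize r d.fst = c at h0 ⊢
      revert a b c
      decide
  have hr0 : ∑ d : G.Dart, r d.fst = 0 := by
    rw [← Finset.sum_congr rfl fun d _ => hdiff d, Finset.sum_sub_distrib,
      Equiv.sum_comp R.next (fun d => r d.fst * κ d.fst d.snd), sub_self]
  rw [Finset.sum_sub_distrib, hr0, sub_zero] at hy
  exact hft' hy

/-- A connected near-triangulation in which all neighbourhoods are bipartite is 3-colourable. -/
theorem IsSpherical.colorable_three {R : RotationSystem G} (hR : R.IsSpherical)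
    [Finite V] (hconn : G.Connected) (hiso : ∀ v, ∃ u, G.Adj v u) (outer : R.Region)
    (htri : ∀ q, q ≠ outer → Nat.card {d : G.Dart // R.region d = q} = 3)
    {κ : V → V → ZMod 2}
    (hκ : ∀ v x y, G.Adj v x → G.Adj v y → G.Adj x y → κ v x ≠ κ v y) :
    G.Colorable 3 := by
  classical
  have := Fintype.ofFinite V
  have := Fintype.ofFinite G.Dart
  obtain ⟨s, hs⟩ := hR.exists_region_bicoloring hconn hiso outer htri hκ
  let sign : ZMod 2 → ZMod 3 := fun a => if a = 0 then 1 else -1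
  have sign_ne : ∀ a, sign a ≠ 0 := by decide
  have sign_eq : ∀ a b, a + b = 1 → sign b = -sign a := by decide
  let enc := Fintype.equivFin V
  -- An edge with the outer face on both sides has no triangle to fix its sign; an enumeration of
  -- the vertices picks one antisymmetrically.
  let f : G.Dart → ZMod 3 := fun d =>
    if R.region d ≠ outer then sign (s (R.region d))
    else if R.region d.symm ≠ outer then -sign (s (R.region d.symm))
    else if enc d.fst < enc d.snd then 1 else -1
  have hf0 : ∀ d, f d ≠ 0 := by
    intro d
    simp only [f]
    split_ifs
    · exact sign_ne _
    · exact neg_ne_zero.2 (sign_ne _)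
    · decide
    · decide
  have hf : ∀ d, f d.symm = -f d := by
    intro d
    by_cases h1 : R.region d = outer <;> by_cases h2 : R.region d.symm = outer
    · have hne : enc d.fst ≠ enc d.snd := fun h => d.fst_ne_snd (enc.injective h)
      rcases lt_or_gt_of_ne hne with h | h
      · simp [f, h1, h2, h, h.not_gt]
      · simp [f, h1, h2, h, h.not_gt]
    · simp [f, h1, h2]
    · simp [f, h1, h2]
    · simp only [f, ne_eq, h1, h2, not_false_eq_true, if_true]
      exact sign_eq _ _ (hs d h1 h2)
  have hinner : ∀ q, q ≠ outer → ∑ d with R.region d = q, f d = 0 := by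
    intro q hq
    have h1 : ∀ d ∈ Finset.univ.filter (fun d => R.region d = q), f d = sign (s q) := by
      intro d hd
      have hd' : R.region d = q := by simpa using hd
      simp [f, hd', hq]
    have h2 := htri q hq
    rw [Nat.card_eq_fintype_card, Fintype.card_subtype] at h2
    rw [Finset.sum_congr rfl h1, Finset.sum_const, h2]
    generalize sign (s q) = a
    revert a
    decide
  -- Antisymmetry makes the sum over all darts vanish, so the outer face needs no condition on its
  -- length.
  have htotal : ∑ d, f d = 0 := by
    have h : ∑ d : G.Dart, f d.symm = ∑ d, f d :=
      Equiv.sum_comp (Function.Involutive.toPerm _ SimpleGraph.Dart.symm_involutive) f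
    simp only [hf, Finset.sum_neg_distrib] at h
    generalize ∑ d, f d = a at h ⊢
    revert a
    decide
  have hsum : ∀ q, ∑ d with R.region d = q, f d = 0 := by
    have := Fintype.ofFinite R.Region
    intro q
    by_cases hq : q = outer
    · subst hq
      rw [← Finset.sum_fiberwise Finset.univ R.region f] at htotal
      rwa [Finset.sum_eq_single q (fun q' _ h => hinner q' h) (by simp)] at htotal
    · exact hinner q hq
  obtain ⟨p, hp⟩ := hR.exists_potential hconn hiso hf hsum
  refine ⟨SimpleGraph.Coloring.mk (fun v => (p v : Fin 3)) fun {u v} huv h => ?_⟩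
  have h' : p u = p v := h
  exact hf0 ⟨(u, v), huv⟩ (by rw [hp]; simp [h'])

end RotationSystem

/-- A near-triangulation in which all neighbourhoods are bipartite is 3-colourable. -/
theorem IsNearTriangulation.colorable_three {V : Type*} [Finite V] {G : SimpleGraph V}
    (hG : IsNearTriangulation G) {κ : V → V → ZMod 2}
    (hκ : ∀ v x y, G.Adj v x → G.Adj v y → G.Adj x y → κ v x ≠ κ v y) :
    G.Colorable 3 := by
  rw [SimpleGraph.colorable_iff_forall_connectedComponent]
  intro c
  obtain ⟨R, hR, outer, houter⟩ := hG c
  have hconn := c.connected_toSimpleGraph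
  rcases subsingleton_or_nontrivial c with hc | hc
  · exact ⟨SimpleGraph.Coloring.mk (fun _ => 0) fun {u v} huv =>
      absurd (Subsingleton.elim u v) huv.ne⟩
  have hiso : ∀ v, ∃ u, c.toSimpleGraph.Adj v u := fun v =>
    hconn.preconnected.exists_adj_of_nontrivial v
  rcases outer with q | v
  · refine hR.colorable_three hconn hiso q (fun q' hq' => ?_) (κ := fun v x => κ v x)
      fun v x y hx hy hxy => hκ v x y hx hy hxy
    exact houter (Sum.inl q') (fun h => hq' (Sum.inl.inj h))
  -- A face without darts surrounds an isolated vertex, which a connected graph with more than one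
  -- vertex does not have.
  · obtain ⟨u, hu⟩ := hiso v.1
    exact absurd hu (v.2 u)

theorem theorem2p1 {V : Type*} [Finite V] (G : SimpleGraph V)
    (hG : IsNearTriangulation G) (hK4 : G.CliqueFree 4) :
    G.Colorable 3 ↔ IsWordRepresentable G := by
  refine ⟨fun h => h.isWordRepresentable, fun h => ?_⟩
  choose κ hκ using h.exists_neighbor_bicoloring hK4
  exact hG.colorable_three hκ
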